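/- Let $\mathcal X$ denote a real Banach space with $\dim\mathcal X\ge 2$, dual $\mathcal X^*$ and unit sphere $S_{\mathcal X}$. Its modulus of convexity is $\delta_{\mathcal X}(\varepsilon)=\inf\{1-\|y+\tilde y\|/2 : y,\tilde y\in S_{\mathcal X},\ \|y-\tilde y\|=\varepsilon\}$ for $0\le\varepsilon\le2$, and its modulus of smoothness is $\rho_{\mathcal X}(\tau)=\sup\{(\|x+\tau y\|+\|x-\tau y\|)/2-1 : x,y\in S_{\mathcal X}\}$ for $\tau\ge0$. $\mathcal X$ is uniformly convex if $\delta_{\mathcal X}(\varepsilon)>0$ for all $\varepsilon\in(0,2]$, and uniformly smooth if $\rho_{\mathcal X}(\tau)/\tau\to0$ as $\tau\downarrow0$. For $F:\mathcal X\to\mathbb R$, $x\in\mathcal X$, $x^*\in\mathcal X^*$, $\tau\ge 0$ put $$\rho_{F,x}^{x^*}(\tau)=\sup_{\|y-x\|=\tau}|F(y)-F(x)-\langle x^*,y-x\rangle|,\qquad \delta_{F,x}^{x^*}(\tau)=\inf_{\|y-x\|=\tau}|F(y)-F(x)-\langle x^*,y-x\rangle| .$$ For $p>1$ let $J_p(x)=\{x^*\in\mathcal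 X^* : \langle x^*,x\rangle=\|x^*\|\,\|x\|,\ \|x^*\|=\|x\|^{p-1}\}$; a selection of $J_p$ is a map $j_p:\mathcal X\to\mathcal X^*$ with $j_p(x)\in J_p(x)$ for all $x\in\mathcal X$. **Theorem.** There are constants $C_{\overline\tau,p}>0$ and $D_{\overline\tau,p}>0$, depending only on $\overline\tau>0$ and $p>1$, such that for every $p>1$, every real Banach space $\mathcal X$ with $\dim\mathcal X\ge2$ and every selection $j_p$ of $J_p$, the following holds with $F=\frac1p\|\cdot\|^p$. 1. For all $\overline\tau>0$, $x\in S_{\mathcal X}$ and $0\le\tau\le\overline\tau$: $\ \rho_{F,x}^{j_p(x)}(\tau)\le C_{\overline\tau,p}\,\rho_{\mathcal X}(\tau)$. 2. If $\overline\tau>0$ and $\phi:(0,\infty)\to\mathbb R$ satisfy $\rho_{F,x}^{j_p(x)}(\tau)\le\phi(\tau)$ for all $x\in S_{\mathcal X}$ and $0<\tau\le\overline\tau$, then $\rho_{\mathcal X}(\tau)\le\phi(\tau)+D_{\overline\tau,p}\,\tau^2$ for all $0<\tau\le\overline\tau$. In particular, if moreover $\phi(\tau)/\tau\to0$ as $\tau\downarrow0$,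 then $\mathcal X$ is uniformly smooth. 3. Let $\frac1p+\frac1{p'}=1$. For all $\overline\tau>0$ we have $\rho_{\mathcal X^*}(\overline\tau)/\overline\tau>0$, and for all $x\in S_{\mathcal X}$ and $0\le\tau\le C_{\overline\tau,p'}\,\rho_{\mathcal X^*}(\overline\tau)/\overline\tau$: $$\delta_{F,x}^{j_p(x)}(\tau)\ge C_{\overline\tau,p'}\,\delta_{\mathcal X}\!\left(\tau/C_{\overline\tau,p'}\right),$$ where $C_{\overline\tau,p'}$ is the constant of part 1 for the exponent $p'$. 4. If there are $\overline\tau>0$ and a nondecreasing $\phi:(0,\infty)\to(0,\infty)$ with $\delta_{F,x}^{j_p(x)}(\tau)\ge\phi(\tau)$ for all $x\in S_{\mathcal X}$ and $0<\tau\le\overline\tau$, then $\mathcal X$ is uniformly convex. -/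

import Mathlib

open Set Filter Topology

noncomputable section

namespace BregmanNorm

section Space

variable (X : Type*) [NormedAddCommGroup X] [NormedSpace ℝ X]

/-- The modulus of convexity of the space `X` (meaningful for `0 ≤ ε ≤ 2`). -/
def convexityModulus (ε : ℝ) : ℝ :=
  sInf {r : ℝ | ∃ y z : X, ‖y‖ = 1 ∧ ‖z‖ = 1 ∧ ‖y - z‖ = ε ∧ r = 1 - ‖y + z‖ / 2}

/-- The modulus of smoothness of the space `X` (meaningful for `0 ≤ τ`). -/
def smoothnessModulus (τ : ℝ) : ℝ :=
  sSup {r : ℝ | ∃ x y : X, ‖x‖ = 1 ∧ ‖y‖ = 1 ∧ r = (‖x + τ • y‖ + ‖x - τ • y‖) / 2 - 1}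

/-- `X` is uniformly convex: its modulus of convexity is positive on `(0, 2]`. -/
def UniformlyConvex : Prop :=
  ∀ ε : ℝ, 0 < ε → ε ≤ 2 → 0 < convexityModulus X ε

/-- `X` is uniformly smooth: its modulus of smoothness is `o(τ)` as `τ → 0`. -/
def UniformlySmooth : Prop :=
  Tendsto (fun τ : ℝ => smoothnessModulus X τ / τ) (𝓝[>] 0) (𝓝 0)

end Space

section Functional

variable {X : Type*} [NormedAddCommGroup X] [NormedSpace ℝ X]

/-- The linearization error `F y - F x - ⟨ξ, y - x⟩` of a finite functional `F`. -/
def linError (F : X → ℝ) (ξ : StrongDual ℝ X) (y x : X) : ℝ :=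
  F y - F x - ξ (y - x)

/-- The modulus of smoothness of `F` in `x` with respect to `ξ`, with values in the extended
reals (so that no finiteness of the supremum is presupposed). -/
def smoothnessModulusAt (F : X → ℝ) (x : X) (ξ : StrongDual ℝ X) (τ : ℝ) : EReal :=
  ⨆ (y : X) (_ : ‖x - y‖ = τ), ((|linError F ξ y x| : ℝ) : EReal)

/-- The modulus of convexity of `F` in `x` with respect to `ξ`. -/
def convexityModulusAt (F : X → ℝ) (x : X) (ξ : StrongDual ℝ X) (τ : ℝ) : EReal :=
  ⨅ (y : X) (_ : ‖x - y‖ = τ), ((|linError F ξ y x| : ℝ) : EReal)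

/-- The functional `(1 / p) ‖x‖ ^ p`. -/
def normPow (p : ℝ) (x : X) : ℝ := 1 / p * ‖x‖ ^ p

/-- The (set-valued) duality mapping `J_p`. -/
def dualityMap (p : ℝ) (x : X) : Set (StrongDual ℝ X) :=
  {ξ | ξ x = ‖ξ‖ * ‖x‖ ∧ ‖ξ‖ = ‖x‖ ^ (p - 1)}

/-- `j` is a selection of the duality mapping `J_p`. -/
def IsDualitySelection (p : ℝ) (j : X → StrongDual ℝ X) : Prop :=
  ∀ x : X, j x ∈ dualityMap p x

end Functional

end BregmanNorm

end

/-! For a unit vector `x`, `ξ = j x` has norm 1 and attains it at `x`. The error `E(y) = ‖y‖^p/p -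
1/p - ξ y + 1` is nonnegative, since `t^p/p - 1/p ≥ t - 1` and `ξ y ≤ ‖y‖`, and it is convex in `y`.

Upper bound: in `E(x + τv) ≤ E(x + τv) + E(x - τv)` the linear parts cancel, and replacing powers by
norms costs `O(τ²)`. In dimension at least 2 this cost is absorbed by `τ² ≤ const · ρ_X(τ)`
(`sq_le_smoothnessModulus`). Conversely, averaging `E(x ± τv)` already dominates the quotient
defining `ρ_X`.

Lower bound: Young's inequality at `ξ + σg`, with `g` norming `y - x`, gives `E(y) ≥ σ‖y - x‖ - E*(ξ
+ σg)`, where `E*` is the error on the dual for the conjugate exponent. The upper bound there yields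
`E(y) ≥ σ‖y - x‖ - C ρ_{X*}(σ)`, and `exists_convexityModulus_le` picks `σ` to reach `C δ_X(‖y -
x‖/C)`. Conversely, for unit `y`, `z` and `x` the direction of `y + z`, `E(y) + E(z) = 2 - ‖y + z‖`,
and one of the two points is far from `x`. -/

namespace BregmanNorm

/-! ### Powers near 1 -/

lemma abs_rpow_sub_one_le {q M a : ℝ} (hq : 0 < q) (ha : 0 ≤ a) (haM : a ≤ M) (hM : 1 ≤ M) :
    |a ^ q - 1| ≤ (1 + q * M ^ q) * |a - 1| := by
  have hMq : 0 ≤ q * M ^ q := by positivity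
  have key : |a ^ q - 1| ≤ |a - 1| ∨ |a ^ q - 1| ≤ q * M ^ q * |a - 1| := by
    rcases le_total q 1 with hq1 | hq1
    · left
      rcases le_total a 1 with h | h
      · have h1 : a ^ q ≤ 1 := Real.rpow_le_one ha h hq.le
        have h2 : a ≤ a ^ q := by
          rcases ha.eq_or_lt with h0 | h0
          · rw [← h0]; positivity
          · simpa using Real.rpow_le_rpow_of_exponent_ge h0 h hq1
        rw [abs_of_nonpos (by linarith), abs_of_nonpos (by linarith)]; linarith
      · have h1 : 1 ≤ a ^ q := Real.one_le_rpow h hq.le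
        have h2 : a ^ q ≤ a := by simpa using Real.rpow_le_rpow_of_exponent_le h hq1
        rw [abs_of_nonneg (by linarith), abs_of_nonneg (by linarith)]; linarith
    · right
      have hM1 : 1 ≤ M ^ q := Real.one_le_rpow hM hq.le
      rcases le_total a 1 with h | h
      · have h1 : a ^ q ≤ 1 := Real.rpow_le_one ha h hq.le
        have h2 : 1 + q * (a - 1) ≤ a ^ q := by
          simpa using one_add_mul_self_le_rpow_one_add (s := a - 1) (by linarith) hq1
        rw [abs_of_nonpos (by linarith), abs_of_nonpos (by linarith)]
        nlinarith [mul_nonneg (mul_nonneg hq.le (sub_nonneg.2 hM1)) (sub_nonneg.2 h)]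
      · have h1 : 1 ≤ a ^ q := Real.one_le_rpow h hq.le
        have h0 : 0 < a := by linarith
        have h2 : 1 + q * (1 / a - 1) ≤ (1 / a) ^ q := by
          simpa using one_add_mul_self_le_rpow_one_add (s := 1 / a - 1)
            (by have : 0 < 1 / a := by positivity
                linarith) hq1
        rw [Real.div_rpow zero_le_one ha, Real.one_rpow] at h2
        have h3 : a ^ q ≤ M ^ q := Real.rpow_le_rpow ha haM hq.le
        have h4 : a ^ q - 1 ≤ q * a ^ q * (1 - 1 / a) := by
          have := mul_le_mul_of_nonneg_right h2 (zero_le_one.trans h1)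
          rw [div_mul_cancel₀ _ (by positivity)] at this
          linarith
        have h5 : 1 - 1 / a ≤ a - 1 := by
          rw [← sub_nonneg]
          have : a - 1 - (1 - 1 / a) = (a - 1) ^ 2 / a := by field_simp
          rw [this]; positivity
        rw [abs_of_nonneg (by linarith), abs_of_nonneg (by linarith)]
        calc a ^ q - 1 ≤ q * a ^ q * (1 - 1 / a) := h4
          _ ≤ q * a ^ q * (a - 1) := by gcongr
          _ ≤ q * M ^ q * (a - 1) := by
            have := sub_nonneg.2 h
            gcongr
  rw [add_mul, one_mul]
  rcases key with h | h
  · exact h.trans (le_add_of_nonneg_right (by positivity))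
  · exact h.trans (le_add_of_nonneg_left (by positivity))

/-- Bernoulli at `1/a` gives `a^p - 1 ≤ p a^(p-1) (a - 1)`; replacing the slope `p a^(p-1)` by `p`
costs a Lipschitz term. Expanding at 1 keeps the bound quadratic down to `a = 0`, even for `p < 2`.
-/
lemma rpow_le_quadratic {p M a : ℝ} (hp : 1 < p) (ha : 0 ≤ a) (haM : a ≤ M) (hM : 1 ≤ M) :
    a ^ p ≤ 1 + p * (a - 1) + p * (1 + (p - 1) * M ^ (p - 1)) * (a - 1) ^ 2 := by
  have hp0 : 0 < p := by linarith
  have h1 : a ^ p - 1 ≤ p * a ^ (p - 1) * (a - 1) := by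
    rcases ha.eq_or_lt with h0 | h0
    · rw [← h0, Real.zero_rpow hp0.ne', Real.zero_rpow (by linarith)]; norm_num
    · have h2 : 1 + p * (1 / a - 1) ≤ (1 / a) ^ p := by
        simpa using one_add_mul_self_le_rpow_one_add (s := 1 / a - 1)
          (by have : 0 < 1 / a := by positivity
              linarith) hp.le
      rw [Real.div_rpow zero_le_one ha, Real.one_rpow, le_div_iff₀ (by positivity)] at h2
      have h3 : a ^ p = a ^ (p - 1) * a := by
        rw [← Real.rpow_add_one h0.ne']; ring_nf
      have h4 : (1 + p * (1 / a - 1)) * a ^ p = a ^ p + p * a ^ (p - 1) * (1 - a) := by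
        rw [h3]; field_simp
      linarith
  have h2 := abs_rpow_sub_one_le (q := p - 1) (by linarith) ha haM hM
  have h3 : (a ^ (p - 1) - 1) * (a - 1) ≤ (1 + (p - 1) * M ^ (p - 1)) * (a - 1) ^ 2 := by
    calc (a ^ (p - 1) - 1) * (a - 1) ≤ |a ^ (p - 1) - 1| * |a - 1| := by
          rw [← abs_mul]; exact le_abs_self _
      _ ≤ (1 + (p - 1) * M ^ (p - 1)) * |a - 1| * |a - 1| := by gcongr
      _ = _ := by rw [mul_assoc, abs_mul_abs_self, sq]
  nlinarith [mul_le_mul_of_nonneg_left h3 hp0.le]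

/-! ### Dimension at least two, for the space and its dual -/

variable {X : Type*} [NormedAddCommGroup X] [NormedSpace ℝ X]

/-- This form of the dimension hypothesis transfers directly to the dual. -/
lemma exists_ne_zero_apply_eq_zero (hX : 2 ≤ Module.rank ℝ X) (f : StrongDual ℝ X) :
    ∃ u : X, u ≠ 0 ∧ f u = 0 := by
  by_contra! h
  have hinj : Function.Injective f.toLinearMap := by
    rw [← LinearMap.ker_eq_bot, LinearMap.ker_eq_bot']
    intro u hu
    by_contra h0
    exact h u h0 hu
  have := LinearMap.lift_rank_le_of_injective f.toLinearMap hinj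
  rw [Module.rank_self, Cardinal.lift_one, Cardinal.lift_le_one_iff] at this
  exact absurd (hX.trans this) (by norm_num)

lemma exists_ne_zero_apply_eq_zero_dual
    (hX : ∀ f : StrongDual ℝ X, ∃ u : X, u ≠ 0 ∧ f u = 0)
    (g : StrongDual ℝ (StrongDual ℝ X)) : ∃ f : StrongDual ℝ X, f ≠ 0 ∧ g f = 0 := by
  obtain ⟨u₀, h₀, -⟩ := hX 0
  obtain ⟨f₁, hf₁, -⟩ := exists_dual_vector ℝ u₀ (norm_ne_zero_iff.2 h₀)
  obtain ⟨u, hu, hfu⟩ := hX f₁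
  obtain ⟨f₂, -, hf₂⟩ := exists_dual_vector ℝ u (norm_ne_zero_iff.2 hu)
  have hf₁0 : f₁ ≠ 0 := by rintro rfl; simp at hf₁
  by_cases h : g f₁ = 0
  · exact ⟨f₁, hf₁0, h⟩
  · refine ⟨g f₁ • f₂ - g f₂ • f₁, fun h0 => ?_, by simp; ring⟩
    have := congrArg (fun f : StrongDual ℝ X => f u) h0
    simp [hfu, hf₂, h, hu] at this

/-! ### The modulus of smoothness and its quadratic lower bound -/

lemma le_smoothnessModulus {τ : ℝ} (hτ : 0 ≤ τ) {x y : X} (hx : ‖x‖ = 1) (hy : ‖y‖ = 1) :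
    (‖x + τ • y‖ + ‖x - τ • y‖) / 2 - 1 ≤ smoothnessModulus X τ := by
  refine le_csSup ⟨τ, ?_⟩ ⟨x, y, hx, hy, rfl⟩
  rintro r ⟨x, y, hx, hy, rfl⟩
  have h1 := norm_add_le x (τ • y)
  have h2 := norm_sub_le x (τ • y)
  rw [norm_smul, Real.norm_of_nonneg hτ, hx, hy] at h1 h2
  linarith

lemma smoothnessModulus_le [Nontrivial X] {τ b : ℝ}
    (h : ∀ x y : X, ‖x‖ = 1 → ‖y‖ = 1 → (‖x + τ • y‖ + ‖x - τ • y‖) / 2 - 1 ≤ b) :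
    smoothnessModulus X τ ≤ b := by
  obtain ⟨x, hx⟩ := exists_norm_eq X zero_le_one
  refine csSup_le ⟨_, x, x, hx, hx, rfl⟩ ?_
  rintro r ⟨x, y, hx, hy, rfl⟩
  exact h x y hx hy

lemma smoothnessModulus_le_self [Nontrivial X] {τ : ℝ} (hτ : 0 ≤ τ) :
    smoothnessModulus X τ ≤ τ := by
  refine smoothnessModulus_le fun x y hx hy => ?_
  have h1 := norm_add_le x (τ • y)
  have h2 := norm_sub_le x (τ • y)
  rw [norm_smul, Real.norm_of_nonneg hτ, hx, hy] at h1 h2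
  linarith

lemma smoothnessModulus_nonneg [Nontrivial X] {τ : ℝ} (hτ : 0 ≤ τ) :
    0 ≤ smoothnessModulus X τ := by
  obtain ⟨x, hx⟩ := exists_norm_eq X zero_le_one
  have h1 := le_smoothnessModulus hτ hx hx
  have h2 := norm_add_le (x + τ • x) (x - τ • x)
  have h3 : ‖x + τ • x + (x - τ • x)‖ = 2 := by
    rw [show x + τ • x + (x - τ • x) = (2 : ℝ) • x by rw [two_smul]; abel, norm_smul, hx]; norm_num
  linarith

/-- Compare the norm with the form `q = f₁² + f₂²`, scaled so that `q ≤ M ‖·‖²` is nearly attained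
at a unit vector `u`. For `v` `q`-orthogonal to `u`, `q (u ± τv) = q u + τ² q v`, so both norms
exceed 1 by order `τ²`. -/
lemma sq_le_smoothnessModulus (hX : ∀ f : StrongDual ℝ X, ∃ u : X, u ≠ 0 ∧ f u = 0)
    {τ τ₀ : ℝ} (hτ : 0 ≤ τ) (hτ₀ : τ ≤ τ₀) :
    τ ^ 2 ≤ 10 * (2 + τ₀) * smoothnessModulus X τ := by
  obtain ⟨u₀, h₀, -⟩ := hX 0
  have : Nontrivial X := ⟨u₀, 0, h₀⟩
  obtain ⟨u₁, hu₁⟩ := exists_norm_eq X zero_le_one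
  obtain ⟨f₁, hf₁, hfu₁⟩ := exists_dual_vector' ℝ u₁
  obtain ⟨w, hw, hfw⟩ := hX f₁
  set u₂ : X := ‖w‖⁻¹ • w
  have hu₂ : ‖u₂‖ = 1 := by simp [u₂, norm_smul, hw]
  have hfu₂ : f₁ u₂ = 0 := by simp [u₂, hfw]
  obtain ⟨f₂, hf₂, hfu₂'⟩ := exists_dual_vector' ℝ u₂
  simp only [hu₁, hu₂] at hfu₁ hfu₂'
  have hq : ∀ x : X, f₁ x ^ 2 + f₂ x ^ 2 ≤ 2 * ‖x‖ ^ 2 := by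
    intro x
    have h1 := f₁.le_opNorm x
    have h2 := f₂.le_opNorm x
    rw [hf₁, one_mul, Real.norm_eq_abs] at h1
    rw [hf₂, one_mul, Real.norm_eq_abs] at h2
    have := sq_le_sq' (by linarith [neg_abs_le (f₁ x), abs_nonneg (f₁ x)]) ((le_abs_self _).trans h1)
    have := sq_le_sq' (by linarith [neg_abs_le (f₂ x), abs_nonneg (f₂ x)]) ((le_abs_self _).trans h2)
    linarith
  have hlow : ∀ a b : ℝ, ‖a • u₁ + b • u₂‖ ^ 2 ≤
      5 * (f₁ (a • u₁ + b • u₂) ^ 2 + f₂ (a • u₁ + b • u₂) ^ 2) := by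
    intro a b
    have h1 : f₁ (a • u₁ + b • u₂) = a := by simp [hfu₁, hfu₂]
    have h2 : f₂ (a • u₁ + b • u₂) = a * f₂ u₁ + b := by simp [hfu₂']
    have h3 : ‖a • u₁ + b • u₂‖ ≤ |a| + |b| := by
      simpa [norm_smul, hu₁, hu₂] using norm_add_le (a • u₁) (b • u₂)
    have h4 : |f₂ u₁| ≤ 1 := by simpa [hf₂, hu₁] using f₂.le_opNorm u₁
    set c := a * f₂ u₁ + b with hc
    have h5 : |b| ≤ |c| + |a| := by
      have : b = c - a * f₂ u₁ := by rw [hc]; ring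
      calc |b| ≤ |c| + |a * f₂ u₁| := by rw [this]; exact abs_sub _ _
        _ ≤ |c| + |a| := by
          rw [abs_mul]; gcongr; exact mul_le_of_le_one_right (abs_nonneg _) h4
    rw [h1, h2]
    have h6 : ‖a • u₁ + b • u₂‖ ≤ 2 * |a| + |c| := by linarith
    calc ‖a • u₁ + b • u₂‖ ^ 2 ≤ (2 * |a| + |c|) ^ 2 := by gcongr
      _ ≤ 5 * (|a| ^ 2 + |c| ^ 2) := by nlinarith [sq_nonneg (|a| - 2 * |c|)]
      _ = _ := by rw [sq_abs, sq_abs]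
  set S : Set ℝ := {r | ∃ x : X, ‖x‖ = 1 ∧ r = f₁ x ^ 2 + f₂ x ^ 2}
  have hSb : BddAbove S := ⟨2, by rintro r ⟨x, hx, rfl⟩; simpa [hx] using hq x⟩
  set M := sSup S
  have hM2 : M ≤ 2 := csSup_le ⟨_, u₁, hu₁, rfl⟩ (by rintro r ⟨x, hx, rfl⟩; simpa [hx] using hq x)
  have hM1 : 1 ≤ M := by
    refine le_trans ?_ (le_csSup hSb ⟨u₁, hu₁, rfl⟩)
    simp only [hfu₁]; norm_num; positivity
  have hMx : ∀ x : X, f₁ x ^ 2 + f₂ x ^ 2 ≤ M * ‖x‖ ^ 2 := by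
    intro x
    rcases eq_or_ne x 0 with rfl | hx
    · simp
    have hx' : 0 < ‖x‖ := norm_pos_iff.2 hx
    have := le_csSup hSb ⟨‖x‖⁻¹ • x, by simp [norm_smul, hx], rfl⟩
    simp only [map_smul, smul_eq_mul, mul_pow, ← mul_add, inv_pow] at this
    rwa [inv_mul_le_iff₀ (by positivity), mul_comm] at this
  set ρ := smoothnessModulus X τ
  have hρ0 : 0 ≤ ρ := smoothnessModulus_nonneg hτ
  have hρτ : ρ ≤ τ := smoothnessModulus_le_self hτ
  have key : 1 + τ ^ 2 / 10 ≤ (1 + ρ) ^ 2 := by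
    refine le_of_forall_pos_le_add fun ε hε => ?_
    obtain ⟨_, ⟨u, hu, rfl⟩, hlt⟩ := exists_lt_of_lt_csSup (s := S) (b := M - ε)
      ⟨_, u₁, hu₁, rfl⟩ (by linarith)
    obtain ⟨v, hv, hvB, hvq⟩ : ∃ v : X, ‖v‖ = 1 ∧ f₁ u * f₁ v + f₂ u * f₂ v = 0 ∧
        1 ≤ 5 * (f₁ v ^ 2 + f₂ v ^ 2) := by
      obtain ⟨a, b, hab, hB⟩ : ∃ a b : ℝ, a • u₁ + b • u₂ ≠ 0 ∧
          f₁ u * f₁ (a • u₁ + b • u₂) + f₂ u * f₂ (a • u₁ + b • u₂) = 0 := by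
        have hne : ∀ a b : ℝ, a • u₁ + b • u₂ = 0 → a = 0 ∧ b = 0 := by
          intro a b h
          have h1 : a = 0 := by simpa [hfu₁, hfu₂] using congrArg f₁ h
          have h2 : b = 0 := by simpa [h1, hfu₂'] using congrArg f₂ h
          exact ⟨h1, h2⟩
        by_cases h : f₁ u * f₁ u₁ + f₂ u * f₂ u₁ = 0
        · exact ⟨1, 0, fun h' => one_ne_zero (hne _ _ h').1, by simpa using h⟩
        · refine ⟨f₁ u * f₁ u₂ + f₂ u * f₂ u₂, -(f₁ u * f₁ u₁ + f₂ u * f₂ u₁),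
            fun h' => h (neg_eq_zero.1 (hne _ _ h').2), ?_⟩
          simp only [map_add, map_smul, smul_eq_mul]; ring
      set v₀ := a • u₁ + b • u₂ with hv₀
      have hn : 0 < ‖v₀‖ := norm_pos_iff.2 hab
      refine ⟨‖v₀‖⁻¹ • v₀, by simp [norm_smul, hab], ?_, ?_⟩
      · simp only [map_smul, smul_eq_mul]
        linear_combination ‖v₀‖⁻¹ * hB
      · have := hlow a b
        rw [← hv₀] at this
        simp only [map_smul, smul_eq_mul, mul_pow, inv_pow, ← mul_add]
        rw [mul_left_comm, le_inv_mul_iff₀ (by positivity), mul_one]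
        exact this
    have hp := hMx (u + τ • v)
    have hm := hMx (u - τ • v)
    have hpp : f₁ (u + τ • v) ^ 2 + f₂ (u + τ • v) ^ 2 =
        f₁ u ^ 2 + f₂ u ^ 2 + τ ^ 2 * (f₁ v ^ 2 + f₂ v ^ 2) := by
      simp only [map_add, map_smul, smul_eq_mul]; linear_combination 2 * τ * hvB
    have hmm : f₁ (u - τ • v) ^ 2 + f₂ (u - τ • v) ^ 2 =
        f₁ u ^ 2 + f₂ u ^ 2 + τ ^ 2 * (f₁ v ^ 2 + f₂ v ^ 2) := by
      simp only [map_sub, map_smul, smul_eq_mul]; linear_combination -2 * τ * hvB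
    have hτq : τ ^ 2 / 5 ≤ τ ^ 2 * (f₁ v ^ 2 + f₂ v ^ 2) := by
      nlinarith [mul_le_mul_of_nonneg_left hvq (sq_nonneg τ)]
    -- Division by `M`: `M ≥ 1` controls the loss `ε`, and `M ≤ 2` turns `τ²/5` into at least
    -- `τ²/10`.
    have low : ∀ r : ℝ, M - ε + τ ^ 2 / 5 ≤ M * r → 1 + τ ^ 2 / 10 ≤ r + ε := by
      intro r hr
      by_contra! hlt'
      have h1 : M * r ≤ M * (1 + τ ^ 2 / 10 - ε) := by gcongr; linarith
      nlinarith [mul_nonneg (sub_nonneg.2 hM2) (sq_nonneg τ), mul_nonneg (sub_nonneg.2 hM1) hε.le,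
        mul_lt_mul_of_pos_left (sub_pos.2 hlt') (by linarith : 0 < M)]
    have hp' := low (‖u + τ • v‖ ^ 2) (by linarith)
    have hm' := low (‖u - τ • v‖ ^ 2) (by linarith)
    have hav := le_smoothnessModulus hτ hu hv
    change _ ≤ ρ at hav
    rcases le_total ‖u + τ • v‖ ‖u - τ • v‖ with h | h
    · have : ‖u + τ • v‖ ^ 2 ≤ (1 + ρ) ^ 2 := by gcongr; linarith
      linarith
    · have : ‖u - τ • v‖ ^ 2 ≤ (1 + ρ) ^ 2 := by gcongr; linarith
      linarith
  nlinarith [mul_le_mul_of_nonneg_left (hρτ.trans hτ₀) hρ0]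

lemma convexityModulus_le {X : Type*} [NormedAddCommGroup X] {y z : X}
    (hy : ‖y‖ = 1) (hz : ‖z‖ = 1) :
    convexityModulus X ‖y - z‖ ≤ 1 - ‖y + z‖ / 2 := by
  refine csInf_le ⟨0, ?_⟩ ⟨y, z, hy, hz, rfl, rfl⟩
  rintro r ⟨y, z, hy, hz, -, rfl⟩
  linarith [norm_add_le y z]

/-! ### The linearization error and its upper bound -/

/-- The constant in the upper bound of the linearization error by the modulus of smoothness. -/
noncomputable def smoothnessConst (τ₀ p : ℝ) : ℝ :=
  2 + 20 * (1 + (p - 1) * (1 + τ₀) ^ (p - 1)) * (2 + τ₀)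

lemma smoothnessConst_pos {τ₀ p : ℝ} (hτ₀ : 0 < τ₀) (hp : 1 < p) : 0 < smoothnessConst τ₀ p := by
  have : 0 < p - 1 := by linarith
  unfold smoothnessConst
  positivity

lemma linError_normPow {p : ℝ} {x y : X} {ξ : StrongDual ℝ X} (hx : ‖x‖ = 1) (hξx : ξ x = 1) :
    linError (normPow p) ξ y x = 1 / p * ‖y‖ ^ p - 1 / p - ξ y + 1 := by
  simp [linError, normPow, hx, hξx]; ring

lemma apply_le_norm {ξ : StrongDual ℝ X} (hξ : ‖ξ‖ = 1) (y : X) : ξ y ≤ ‖y‖ := by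
  simpa [hξ] using (le_abs_self _).trans (ξ.le_opNorm y)

lemma sub_one_le_rpow_div {p a : ℝ} (hp : 1 < p) (ha : 0 ≤ a) : a - 1 ≤ 1 / p * a ^ p - 1 / p := by
  have hp0 : 0 < p := by linarith
  have h : 1 + p * (a - 1) ≤ a ^ p := by
    simpa using one_add_mul_self_le_rpow_one_add (s := a - 1) (by linarith) hp.le
  have : 1 / p * (1 + p * (a - 1)) ≤ 1 / p * a ^ p := by gcongr
  have h2 : 1 / p * (1 + p * (a - 1)) = 1 / p + (a - 1) := by field_simp
  linarith

lemma linError_normPow_nonneg {p : ℝ} (hp : 1 < p) {x : X} {ξ : StrongDual ℝ X} (hx : ‖x‖ = 1)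
    (hξ : ‖ξ‖ = 1) (hξx : ξ x = 1) (y : X) : 0 ≤ linError (normPow p) ξ y x := by
  rw [linError_normPow hx hξx]
  linarith [sub_one_le_rpow_div hp (norm_nonneg y), apply_le_norm hξ y]

lemma linError_normPow_le (hX : ∀ f : StrongDual ℝ X, ∃ u : X, u ≠ 0 ∧ f u = 0)
    {p τ τ₀ : ℝ} (hp : 1 < p) (hτ : 0 ≤ τ) (hτ₀ : τ ≤ τ₀) {x y : X} {ξ : StrongDual ℝ X}
    (hx : ‖x‖ = 1) (hξ : ‖ξ‖ = 1) (hξx : ξ x = 1) (hxy : ‖x - y‖ = τ) :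
    linError (normPow p) ξ y x ≤ smoothnessConst τ₀ p * smoothnessModulus X τ := by
  have hp0 : 0 < p := by linarith
  obtain ⟨v, hv, rfl⟩ : ∃ v : X, ‖v‖ = 1 ∧ y = x + τ • v := by
    rcases eq_or_ne x y with rfl | hne
    · refine ⟨x, hx, ?_⟩
      rw [sub_self, norm_zero] at hxy
      simp [← hxy]
    · have hne' : τ ≠ 0 := by rw [← hxy]; exact norm_ne_zero_iff.2 (sub_ne_zero.2 hne)
      refine ⟨τ⁻¹ • (y - x), ?_, ?_⟩
      · rw [norm_smul, norm_sub_rev, hxy, norm_inv, Real.norm_of_nonneg hτ, inv_mul_cancel₀ hne']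
      · rw [smul_inv_smul₀ hne']; abel
  have hL : 0 ≤ 1 + (p - 1) * (1 + τ₀) ^ (p - 1) := by
    have : 0 ≤ p - 1 := by linarith
    have : 0 ≤ 1 + τ₀ := by linarith
    positivity
  have hquad : ∀ z : X, ‖z - x‖ = τ → 1 / p * ‖z‖ ^ p ≤
      1 / p + (‖z‖ - 1) + (1 + (p - 1) * (1 + τ₀) ^ (p - 1)) * τ ^ 2 := by
    intro z hz
    have h1 : |‖z‖ - 1| ≤ τ := by rw [← hx, ← hz]; exact abs_norm_sub_norm_le z x
    have h2 := rpow_le_quadratic (M := 1 + τ₀) hp (norm_nonneg z)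
      (by linarith [(abs_le.1 h1).2]) (by linarith)
    have h3 : (‖z‖ - 1) ^ 2 ≤ τ ^ 2 := sq_le_sq' (by linarith [(abs_le.1 h1).1]) (abs_le.1 h1).2
    have h4 : 1 / p * ‖z‖ ^ p ≤ 1 / p * (1 + p * (‖z‖ - 1) +
        p * (1 + (p - 1) * (1 + τ₀) ^ (p - 1)) * τ ^ 2) := by
      gcongr
      exact h2.trans (by gcongr)
    refine h4.trans_eq ?_
    field_simp
  have h1 := hquad (x + τ • v) (by simp [norm_smul, hv, hτ])
  have h2 := hquad (x - τ • v) (by simp [norm_smul, hv, hτ])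
  have h3 := linError_normPow_nonneg hp hx hξ hξx (x - τ • v)
  have h4 := le_smoothnessModulus hτ hx hv
  have h5 := sq_le_smoothnessModulus hX hτ hτ₀
  have h6 := mul_le_mul_of_nonneg_left h5 hL
  rw [linError_normPow hx hξx] at h3 ⊢
  simp only [map_add, map_sub, map_smul, hξx] at h3 ⊢
  -- The two norms contribute `2ρ`; the two quadratic terms contribute `2 · 10 (2 + τ₀) ρ` times the
  -- factor from `hquad`.
  unfold smoothnessConst
  linarith

/-! ### Convexity modulus on the unit ball and duality -/

lemma norm_add_norm_le [Nontrivial X] {g h : StrongDual ℝ X} {B : ℝ}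
    (H : ∀ x y : X, ‖x‖ = 1 → ‖y‖ = 1 → g x + h y ≤ B) : ‖g‖ + ‖h‖ ≤ B := by
  obtain ⟨e, he⟩ := exists_norm_eq X zero_le_one
  have h1 : ∀ y : X, ‖y‖ = 1 → ‖g‖ ≤ B - h y := by
    intro y hy
    have h2 : ∀ x : X, ‖x‖ = 1 → ‖g x‖ ≤ B - h y := fun x hx => by
      have := H x y hx hy
      have := H (-x) y (by simpa using hx) hy
      rw [map_neg] at this
      exact abs_le.2 ⟨by linarith, by linarith⟩
    exact ContinuousLinearMap.opNorm_le_of_unit_norm ((norm_nonneg _).trans (h2 e he)) h2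
  have h2 : ∀ y : X, ‖y‖ = 1 → ‖h y‖ ≤ B - ‖g‖ := fun y hy => by
    have := h1 y hy
    have := h1 (-y) (by simpa using hy)
    rw [map_neg] at this
    exact abs_le.2 ⟨by linarith, by linarith⟩
  linarith [ContinuousLinearMap.opNorm_le_of_unit_norm ((norm_nonneg _).trans (h2 e he)) h2]

lemma convexityModulus_le_half {η : ℝ} (hη : 0 ≤ η) : convexityModulus X η ≤ η / 2 := by
  by_cases h : ∃ y z : X, ‖y‖ = 1 ∧ ‖z‖ = 1 ∧ ‖y - z‖ = η
  · obtain ⟨y, z, hy, hz, rfl⟩ := h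
    have h1 := convexityModulus_le hy hz
    have h3 := norm_sub_norm_le ((2 : ℝ) • y) (y - z)
    rw [show (2 : ℝ) • y - (y - z) = y + z by rw [two_smul]; abel, norm_smul, hy] at h3
    norm_num at h3
    linarith
  -- With no pair at distance `η`, the infimum is over the empty set and equals 0.
  · unfold convexityModulus
    refine le_of_eq_of_le ?_ (div_nonneg hη zero_le_two)
    convert Real.sInf_empty
    rw [eq_empty_iff_forall_notMem]
    rintro r ⟨y, z, hy, hz, hyz, -⟩
    exact h ⟨y, z, hy, hz, hyz⟩

/-- A point of the unit ball can be moved along a sphere around `u` to the unit sphere without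
decreasing a norming functional, unless that functional is already far from `2` on `u + v`. -/
lemma exists_norm_eq_one_of_mem_ball {u v w : X} {f : StrongDual ℝ X} (hu : ‖u‖ ≤ 1)
    (hv : ‖v‖ ≤ 1) (hf : ‖f‖ = 1) (hw : ‖w‖ = 1) (hfw : f w = 1) :
    f (u + v) ≤ 2 - ‖v - u‖ ∨ ∃ v' : X, ‖v'‖ = 1 ∧ ‖v' - u‖ = ‖v - u‖ ∧ f v ≤ f v' := by
  set η := ‖v - u‖ with hη
  have hη0 : 0 ≤ η := norm_nonneg _
  have hfu := apply_le_norm hf u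
  have hfvu := apply_le_norm hf (v - u)
  rw [map_sub, ← hη] at hfvu
  rw [map_add]
  rcases eq_or_ne η 0 with h0 | h0
  · left
    linarith [apply_le_norm hf v]
  have hηpos : 0 < η := lt_of_le_of_ne hη0 (Ne.symm h0)
  set d : X := η⁻¹ • (v - u)
  have hd : ‖d‖ = 1 := by rw [norm_smul, ← hη, norm_inv, Real.norm_of_nonneg hη0]; field_simp
  have hvd : v = u + η • d := by simp only [d]; rw [smul_inv_smul₀ h0]; abel
  clear_value d
  -- Only in this case does the segment from `d` to `w` pass through 0, so that it cannot be
  -- normalized.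
  by_cases hdw : d = -w
  · left
    have : f v = f u - η := by rw [hvd, hdw]; simp [hfw]; ring
    linarith
  set c : ℝ → X := fun r => (1 - r) • d + r • w
  have hden : ∀ r ∈ Icc (0 : ℝ) 1, |1 - 2 * r| ≤ ‖c r‖ := by
    intro r hr
    have h1 := abs_norm_sub_norm_le ((1 - r) • d) (-(r • w))
    rw [norm_neg, norm_smul, norm_smul, hd, hw, Real.norm_of_nonneg hr.1,
      Real.norm_of_nonneg (sub_nonneg.2 hr.2), sub_neg_eq_add] at h1
    refine le_of_eq_of_le ?_ h1
    congr 1; ring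
  have hc : ∀ r ∈ Icc (0 : ℝ) 1, 0 < ‖c r‖ := by
    intro r hr
    refine norm_pos_iff.2 fun hcr => hdw ?_
    have h1 := hden r hr
    rw [hcr, norm_zero] at h1
    have h2 : r = 1 / 2 := by linarith [abs_nonpos_iff.1 h1]
    have h3 : (1 / 2 : ℝ) • (d + w) = 0 := by
      rw [← hcr, smul_add]; simp only [c, h2]; norm_num
    rcases smul_eq_zero.1 h3 with h4 | h4
    · norm_num at h4
    · exact eq_neg_of_add_eq_zero_left h4
  have hfd : |f d| ≤ 1 := by simpa [hf, hd] using f.le_opNorm d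
  have hmono : ∀ r ∈ Icc (0 : ℝ) 1, f d ≤ ‖c r‖⁻¹ * f (c r) := by
    intro r hr
    have h1 : f (c r) = (1 - r) * f d + r := by simp [c, hfw]
    have h2 : ‖c r‖ ≤ 1 := by
      refine (norm_add_le _ _).trans_eq ?_
      rw [norm_smul, norm_smul, hd, hw, Real.norm_of_nonneg hr.1,
        Real.norm_of_nonneg (sub_nonneg.2 hr.2)]
      ring
    rw [le_inv_mul_iff₀ (hc r hr), h1]
    have h3 := (le_abs_self _).trans (hden r hr)
    have h4 := abs_le.1 hfd
    -- The sign of `f d` decides which bound on `‖c r‖` helps: `‖c r‖ ≤ 1`, or `1 - 2r ≤ ‖c r‖`.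
    rcases le_total 0 (f d) with h | h
    · nlinarith [mul_le_mul_of_nonneg_right h2 h, hr.1]
    · nlinarith [mul_le_mul_of_nonpos_right h3 h, hr.1]
  set γ : ℝ → X := fun r => u + η • (‖c r‖⁻¹ • c r) with hγ
  have hγc : ContinuousOn (fun r => ‖γ r‖) (Icc 0 1) := by
    have : ContinuousOn (fun r => ‖c r‖⁻¹) (Icc 0 1) :=
      ContinuousOn.inv₀ (by fun_prop) fun r hr => (hc r hr).ne'
    have h2 : Continuous c := by fun_prop
    exact (continuousOn_const.add ((this.smul h2.continuousOn).const_smul η)).norm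
  have hγ0 : γ 0 = v := by simp [γ, c, hd, ← hvd]
  have hγ1 : γ 1 = u + η • w := by simp [γ, c, hw]
  rcases le_total ‖γ 1‖ 1 with h1 | h1
  · left
    have := (apply_le_norm hf (γ 1)).trans h1
    rw [hγ1, map_add, map_smul, hfw, smul_eq_mul] at this
    linarith
  · right
    obtain ⟨r, hr, hr1⟩ := intermediate_value_Icc zero_le_one hγc
      (show (1 : ℝ) ∈ Icc ‖γ 0‖ ‖γ 1‖ from ⟨by rwa [hγ0], h1⟩)
    refine ⟨γ r, hr1, ?_, ?_⟩
    · simp only [hγ, add_sub_cancel_left, norm_smul, norm_inv, norm_norm]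
      rw [inv_mul_cancel₀ (hc r hr).ne', mul_one, Real.norm_of_nonneg hη0]
    · rw [hvd]
      simp only [hγ, map_add, map_smul, smul_eq_mul]
      have := hmono r hr
      gcongr

/-- Push `v`, then `u`, to the sphere at fixed mutual distance without decreasing the functional
norming `u + v`. If a push fails, `‖u + v‖ ≤ 2 - ‖u - v‖`, and `δ(η) ≤ η/2` suffices. -/
lemma convexityModulus_le_of_mem_ball [Nontrivial X] {u v : X} (hu : ‖u‖ ≤ 1) (hv : ‖v‖ ≤ 1) :
    convexityModulus X ‖u - v‖ ≤ 1 - ‖u + v‖ / 2 := by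
  obtain ⟨w, hw, huv⟩ : ∃ w : X, ‖w‖ = 1 ∧ u + v = ‖u + v‖ • w := by
    rcases eq_or_ne (u + v) 0 with h | h
    · obtain ⟨e, he⟩ := exists_norm_eq X zero_le_one
      exact ⟨e, he, by simp [h]⟩
    · exact ⟨‖u + v‖⁻¹ • (u + v), by rw [norm_smul, norm_inv, norm_norm, inv_mul_cancel₀
        (norm_ne_zero_iff.2 h)], by rw [smul_inv_smul₀ (norm_ne_zero_iff.2 h)]⟩
  obtain ⟨f, hf, hfw⟩ := exists_dual_vector' ℝ w
  rw [hw] at hfw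
  change f w = 1 at hfw
  have hfuv : f (u + v) = ‖u + v‖ := by
    conv_lhs => rw [huv]
    simp [hfw]
  have hhalf := convexityModulus_le_half (X := X) (norm_nonneg (u - v))
  rcases exists_norm_eq_one_of_mem_ball hu hv hf hw hfw with h | ⟨v', hv', hv'u, hfv'⟩
  · rw [norm_sub_rev v u] at h
    linarith
  rcases exists_norm_eq_one_of_mem_ball hv'.le hu hf hw hfw with h | ⟨u', hu', hu'v', hfu'⟩
  · rw [norm_sub_rev u v', hv'u, norm_sub_rev v u, map_add] at h
    rw [map_add] at hfuv
    linarith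
  · have h1 := convexityModulus_le hu' hv'
    rw [hu'v', norm_sub_rev u v', hv'u, norm_sub_rev v u] at h1
    have h2 := apply_le_norm hf (u' + v')
    rw [map_add] at h2 hfuv
    linarith

/-- This is the monotonicity of `δ(η)/η`: contracting `x` and `y` towards the direction of `x + y`
by the factor `η/‖x - y‖` gives a pair in the ball at distance `η`. -/
lemma convexityModulus_mul_le [Nontrivial X] {η : ℝ} {x y : X} (hη : 0 < η) (hx : ‖x‖ = 1)
    (hy : ‖y‖ = 1) (hs : η ≤ ‖x - y‖) :
    convexityModulus X η / η * ‖x - y‖ ≤ 1 - ‖x + y‖ / 2 := by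
  set s := ‖x - y‖ with hs'
  have hs0 : 0 < s := hη.trans_le hs
  obtain ⟨w, hw, hxy⟩ : ∃ w : X, ‖w‖ = 1 ∧ x + y = ‖x + y‖ • w := by
    rcases eq_or_ne (x + y) 0 with h | h
    · exact ⟨x, hx, by simp [h]⟩
    · exact ⟨‖x + y‖⁻¹ • (x + y), by rw [norm_smul, norm_inv, norm_norm, inv_mul_cancel₀
        (norm_ne_zero_iff.2 h)], by rw [smul_inv_smul₀ (norm_ne_zero_iff.2 h)]⟩
  set t := η / s with ht
  have ht0 : 0 ≤ t := by positivity
  have ht1 : t ≤ 1 := (div_le_one hs0).2 hs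
  have hball : ∀ z : X, ‖z‖ = 1 → ‖t • z + (1 - t) • w‖ ≤ 1 := by
    intro z hz
    refine (norm_add_le _ _).trans_eq ?_
    rw [norm_smul, norm_smul, hz, hw, Real.norm_of_nonneg ht0,
      Real.norm_of_nonneg (sub_nonneg.2 ht1)]
    ring
  have h1 := convexityModulus_le_of_mem_ball (hball x hx) (hball y hy)
  have h2 : ‖t • x + (1 - t) • w - (t • y + (1 - t) • w)‖ = η := by
    rw [add_sub_add_right_eq_sub, ← smul_sub, norm_smul, Real.norm_of_nonneg ht0, ← hs', ht,
      div_mul_cancel₀ _ hs0.ne']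
  have h3 : ‖t • x + (1 - t) • w + (t • y + (1 - t) • w)‖ = t * ‖x + y‖ + 2 * (1 - t) := by
    have : t • x + (1 - t) • w + (t • y + (1 - t) • w) = (t * ‖x + y‖ + 2 * (1 - t)) • w := by
      rw [add_smul, mul_smul, ← hxy]; module
    rw [this, norm_smul, hw, mul_one, Real.norm_of_nonneg]
    have := sub_nonneg.2 ht1
    positivity
  rw [h2, h3] at h1
  have h4 : convexityModulus X η ≤ t * (1 - ‖x + y‖ / 2) := by linarith
  rw [ht, div_mul_eq_mul_div, le_div_iff₀ hs0] at h4
  rw [div_mul_eq_mul_div, div_le_iff₀ hη]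
  linarith

/-- Half of Lindenstrauss' duality formula. -/
lemma smoothnessModulus_dual_le [Nontrivial X] {σ B : ℝ}
    (h : ∀ x y : X, ‖x‖ = 1 → ‖y‖ = 1 → σ * ‖x - y‖ / 2 - (1 - ‖x + y‖ / 2) ≤ B) (hσ : 0 ≤ σ) :
    smoothnessModulus (StrongDual ℝ X) σ ≤ B := by
  refine smoothnessModulus_le fun f g hf hg => ?_
  have : ‖f + σ • g‖ + ‖f - σ • g‖ ≤ 2 * B + 2 := by
    refine norm_add_norm_le fun x y hx hy => ?_
    have h1 := apply_le_norm hf (x + y)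
    have h2 := mul_le_mul_of_nonneg_left (apply_le_norm hg (x - y)) hσ
    have h3 := h x y hx hy
    simp only [map_add, map_sub] at h1 h2
    simp only [add_apply, sub_apply,
      smul_apply, smul_eq_mul]
    linarith
  linarith

/-- The lower bound comes from a linear functional of small norm. -/
lemma exists_convexityModulus_le [Nontrivial X] {η τ₀ : ℝ} (hη : 0 < η) (hτ₀ : 0 < τ₀)
    (hητ : η ≤ smoothnessModulus (StrongDual ℝ X) τ₀ / τ₀) (hδ : 0 ≤ convexityModulus X η) :
    ∃ σ, 0 ≤ σ ∧ σ ≤ τ₀ ∧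
      convexityModulus X η ≤ σ * η - smoothnessModulus (StrongDual ℝ X) σ := by
  set δ := convexityModulus X η with hδ'
  -- Pairs at distance at most `η` contribute at most `ση/2`; for more distant pairs the loss `1 -
  -- ‖x + y‖/2` outweighs the gain.
  have key : ∀ σ, 0 ≤ σ → σ / 2 ≤ δ / η → smoothnessModulus (StrongDual ℝ X) σ ≤ σ * η / 2 := by
    intro σ hσ hσδ
    refine smoothnessModulus_dual_le (fun x y hx hy => ?_) hσ
    rcases le_total ‖x - y‖ η with h | h
    · have h1 := norm_add_le x y
      have h2 := mul_le_mul_of_nonneg_left h hσ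
      linarith
    · have h1 := convexityModulus_mul_le hη hx hy h
      have h2 := mul_le_mul_of_nonneg_right hσδ (norm_nonneg (x - y))
      have h3 : 0 ≤ σ * η := by positivity
      linarith
  rcases le_total (2 * δ / η) τ₀ with h | h
  -- The largest `σ` allowed by `key`; then `ση/2 = δ`.
  · have h0 : 0 ≤ 2 * δ / η := by positivity
    refine ⟨2 * δ / η, h0, h, ?_⟩
    have h1 := key _ h0 (by rw [mul_div_assoc]; linarith)
    rw [div_mul_cancel₀ _ hη.ne'] at h1 ⊢
    linarith
  -- Otherwise `key` at `τ₀` gives `ρ(τ₀) ≤ τ₀η/2`, against `hητ`.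
  · exfalso
    have h1 := key τ₀ hτ₀.le (by rw [mul_div_assoc] at h; linarith)
    rw [le_div_iff₀ hτ₀] at hητ
    nlinarith [mul_pos hη hτ₀]

/-! ### Converses and the lower bound -/

lemma smoothnessModulus_le_of_linError_le [Nontrivial X] {p τ b : ℝ} (hp : 1 < p) (hτ : 0 ≤ τ)
    {j : X → StrongDual ℝ X} (hj : ∀ x : X, ‖x‖ = 1 → j x x = 1)
    (h : ∀ x y : X, ‖x‖ = 1 → ‖x - y‖ = τ → linError (normPow p) (j x) y x ≤ b) :
    smoothnessModulus X τ ≤ b := by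
  refine smoothnessModulus_le fun x y hx hy => ?_
  have h1 := h x (x + τ • y) hx (by simp [norm_smul, hy, hτ])
  have h2 := h x (x - τ • y) hx (by simp [norm_smul, hy, hτ])
  rw [linError_normPow hx (hj x hx)] at h1 h2
  simp only [map_add, map_sub, hj x hx] at h1 h2
  linarith [sub_one_le_rpow_div hp (norm_nonneg (x + τ • y)), sub_one_le_rpow_div hp (norm_nonneg (x - τ • y))]

lemma uniformlySmooth_of_le [Nontrivial X] {τ₀ : ℝ} (hτ₀ : 0 < τ₀) {φ : ℝ → ℝ}
    (h : ∀ τ, 0 < τ → τ ≤ τ₀ → smoothnessModulus X τ ≤ φ τ)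
    (hφ : Tendsto (fun τ : ℝ => φ τ / τ) (𝓝[>] 0) (𝓝 0)) : UniformlySmooth X := by
  refine tendsto_of_tendsto_of_tendsto_of_le_of_le' tendsto_const_nhds hφ ?_ ?_
  · filter_upwards [self_mem_nhdsWithin] with τ hτ
    exact div_nonneg (smoothnessModulus_nonneg (le_of_lt hτ)) (le_of_lt hτ)
  · filter_upwards [Ioc_mem_nhdsGT hτ₀] with τ hτ
    have := hτ.1
    have := h τ hτ.1 hτ.2
    gcongr

lemma convexityModulus_nonneg {X : Type*} [NormedAddCommGroup X] (ε : ℝ) :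
    0 ≤ convexityModulus X ε := by
  refine Real.sInf_nonneg ?_
  rintro r ⟨y, z, hy, hz, -, rfl⟩
  linarith [norm_add_le y z]

lemma convexityModulus_le_linError (hX : ∀ f : StrongDual ℝ X, ∃ u : X, u ≠ 0 ∧ f u = 0)
    {p p' τ₀ : ℝ} (hp : p.HolderConjugate p') (hτ₀ : 0 < τ₀) {x y : X} {ξ : StrongDual ℝ X}
    (hx : ‖x‖ = 1) (hξ : ‖ξ‖ = 1) (hξx : ξ x = 1)
    (hτ : ‖x - y‖ ≤ smoothnessConst τ₀ p' * (smoothnessModulus (StrongDual ℝ X) τ₀ / τ₀)) :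
    smoothnessConst τ₀ p' * convexityModulus X (‖x - y‖ / smoothnessConst τ₀ p') ≤
      linError (normPow p) ξ y x := by
  have hC : 0 < smoothnessConst τ₀ p' := smoothnessConst_pos hτ₀ hp.symm.lt
  set C := smoothnessConst τ₀ p' with hCdef
  have hE := linError_normPow_nonneg hp.lt hx hξ hξx y
  obtain ⟨u₀, h₀, -⟩ := hX 0
  have : Nontrivial X := ⟨u₀, 0, h₀⟩
  rcases (norm_nonneg (x - y)).eq_or_lt with h0 | hpos
  · rw [← h0, zero_div]
    have := convexityModulus_le_half (X := X) le_rfl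
    rw [zero_div] at this
    exact (mul_nonpos_of_nonneg_of_nonpos hC.le this).trans hE
  obtain ⟨σ, hσ, hστ, hδ⟩ := exists_convexityModulus_le (X := X) (div_pos hpos hC) hτ₀
    (by rwa [div_le_iff₀' hC]) (convexityModulus_nonneg _)
  obtain ⟨g, hg, hgxy⟩ := exists_dual_vector' ℝ (y - x)
  have hgxy' : g y - g x = ‖x - y‖ := by
    rw [← map_sub, norm_sub_rev]; exact hgxy
  -- The upper bound in the dual at `ξ`, where `x` acts as the norming functional in the bidual.
  have hJ := linError_normPow_le (X := StrongDual ℝ X) (p := p') (x := ξ) (y := ξ + σ • g)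
    (ξ := NormedSpace.inclusionInDoubleDual ℝ X x)
    (exists_ne_zero_apply_eq_zero_dual hX) hp.symm.lt hσ hστ hξ
    ((NormedSpace.inclusionInDoubleDualLi ℝ (E := X)).norm_map x |>.trans hx)
    (by simpa using hξx) (by simp [norm_smul, hg, hσ])
  rw [linError_normPow hξ (by simpa using hξx)] at hJ
  simp only [NormedSpace.dual_def, add_apply, smul_apply, smul_eq_mul, hξx, ← hCdef] at hJ
  have hY := Real.young_inequality_of_nonneg (norm_nonneg y) (norm_nonneg (ξ + σ • g)) hp
  have hop := (le_abs_self _).trans ((ξ + σ • g).le_opNorm y)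
  simp only [add_apply, smul_apply, smul_eq_mul] at hop
  rw [linError_normPow hx hξx]
  have hpq : 1 / p + 1 / p' = 1 := by simpa using hp.inv_add_inv_eq_one
  have h1 := mul_le_mul_of_nonneg_left hδ hC.le
  have h2 : C * (σ * (‖x - y‖ / C) - smoothnessModulus (StrongDual ℝ X) σ) =
      σ * (g y - g x) - C * smoothnessModulus (StrongDual ℝ X) σ := by
    rw [hgxy']; field_simp
  rw [h2] at h1
  rw [div_eq_inv_mul, div_eq_inv_mul, ← one_div, ← one_div] at hY
  linarith

/-- Convexity of the error, which vanishes at `x`. It carries lower bounds from the sphere of radius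
`τ₀` to points farther away. -/
lemma linError_normPow_smul_le {p t : ℝ} (hp : 1 < p) (ht : 0 ≤ t) (ht1 : t ≤ 1) {x y : X}
    {ξ : StrongDual ℝ X} (hx : ‖x‖ = 1) (hξx : ξ x = 1) :
    linError (normPow p) ξ (x + t • (y - x)) x ≤ t * linError (normPow p) ξ y x := by
  rw [linError_normPow hx hξx, linError_normPow hx hξx]
  have h1 : ‖x + t • (y - x)‖ ≤ (1 - t) * 1 + t * ‖y‖ := by
    have : x + t • (y - x) = (1 - t) • x + t • y := by module
    rw [this]
    refine (norm_add_le _ _).trans_eq ?_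
    rw [norm_smul, norm_smul, hx, Real.norm_of_nonneg ht, Real.norm_of_nonneg (sub_nonneg.2 ht1)]
  have h2 := (convexOn_rpow hp.le).2 (zero_le_one' ℝ) (norm_nonneg y) (sub_nonneg.2 ht1) ht
    (by ring)
  simp only [smul_eq_mul, Real.one_rpow] at h2
  have h3 : 1 / p * ‖x + t • (y - x)‖ ^ p ≤ 1 / p * ((1 - t) * 1 + t * ‖y‖ ^ p) := by
    gcongr
    exact (Real.rpow_le_rpow (norm_nonneg _) h1 (by linarith)).trans h2
  simp only [map_add, map_smul, map_sub, hξx, smul_eq_mul]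
  linarith

/-- The unit sphere is connected in dimension at least 2. Without such a pair, `sInf ∅ = 0` would
defeat positivity of the modulus. -/
lemma exists_norm_sub_eq (hX : 2 ≤ Module.rank ℝ X) {ε : ℝ} (hε : 0 ≤ ε) (hε2 : ε ≤ 2) :
    ∃ y z : X, ‖y‖ = 1 ∧ ‖z‖ = 1 ∧ ‖y - z‖ = ε := by
  obtain ⟨u₀, h₀, -⟩ := exists_ne_zero_apply_eq_zero hX 0
  have : Nontrivial X := ⟨u₀, 0, h₀⟩
  obtain ⟨e, he⟩ := exists_norm_eq X zero_le_one
  have hpre := isPreconnected_sphere (lt_of_lt_of_le Cardinal.one_lt_two hX) (0 : X) 1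
  have hmem : ε ∈ Icc ‖e - e‖ ‖e - -e‖ := by
    rw [sub_self, norm_zero, sub_neg_eq_add, ← two_smul ℝ e, norm_smul, he]
    exact ⟨hε, by simpa using hε2⟩
  obtain ⟨z, hz, hez⟩ := hpre.intermediate_value (f := fun z => ‖e - z‖)
    (by simpa using he) (by simpa using he) (by fun_prop) hmem
  exact ⟨e, z, he, by simpa using hz, hez⟩

lemma uniformlyConvex_of_le_linError (hX : 2 ≤ Module.rank ℝ X) {p τ₀ : ℝ} (hp : 1 < p)
    (hτ₀ : 0 < τ₀) {j : X → StrongDual ℝ X} (hj : ∀ x : X, ‖x‖ = 1 → ‖j x‖ = 1 ∧ j x x = 1)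
    {φ : ℝ → ℝ} (hmono : MonotoneOn φ (Ioi 0)) (hφ : ∀ τ : ℝ, 0 < τ → 0 < φ τ)
    (h : ∀ x y : X, ‖x‖ = 1 → 0 < ‖x - y‖ → ‖x - y‖ ≤ τ₀ →
      φ ‖x - y‖ ≤ linError (normPow p) (j x) y x) : UniformlyConvex X := by
  intro ε hε hε2
  have hm : 0 < min τ₀ (ε / 2) := by positivity
  set c := φ (min τ₀ (ε / 2)) with hcdef
  have hc : 0 < c := hφ _ hm
  have far : ∀ x y : X, ‖x‖ = 1 → ε / 2 ≤ ‖x - y‖ → c ≤ linError (normPow p) (j x) y x := by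
    intro x y hx hxy
    have hE := linError_normPow_nonneg hp hx (hj x hx).1 (hj x hx).2 y
    rcases le_total ‖x - y‖ τ₀ with hle | hle
    · have hpos : 0 < ‖x - y‖ := by linarith
      exact (hmono hm hpos ((min_le_right _ _).trans hxy)).trans (h x y hx hpos hle)
    · have hpos : 0 < ‖x - y‖ := hτ₀.trans_le hle
      set t := τ₀ / ‖x - y‖ with ht
      have ht0 : 0 ≤ t := by positivity
      have ht1 : t ≤ 1 := (div_le_one hpos).2 hle
      have hd : ‖x - (x + t • (y - x))‖ = τ₀ := by
        rw [sub_add_cancel_left, norm_neg, norm_smul, norm_sub_rev y x, Real.norm_of_nonneg ht0, ht,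
          div_mul_cancel₀ _ hpos.ne']
      have h1 := h x (x + t • (y - x)) hx (by rwa [hd]) hd.le
      rw [hd] at h1
      have h2 := linError_normPow_smul_le hp ht0 ht1 (y := y) hx (hj x hx).2
      have h3 := hmono hm hτ₀ (min_le_left _ _)
      have h4 := mul_le_of_le_one_left hE ht1
      linarith
  -- The value 1 serves antipodal pairs; `c/2` comes from one error being at least `c` and the other
  -- nonnegative.
  refine lt_of_lt_of_le (lt_min (half_pos hc) one_pos) (le_csInf ?_ ?_)
  · obtain ⟨y, z, hy, hz, hyz⟩ := exists_norm_sub_eq hX hε.le hε2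
    exact ⟨_, y, z, hy, hz, hyz, rfl⟩
  rintro r ⟨y, z, hy, hz, hyz, rfl⟩
  rcases eq_or_ne (y + z) 0 with h0 | h0
  · rw [h0, norm_zero, zero_div, sub_zero]
    exact min_le_right _ _
  refine (min_le_left _ _).trans ?_
  have h0' := norm_ne_zero_iff.2 h0
  set x := ‖y + z‖⁻¹ • (y + z) with hxdef
  have hx : ‖x‖ = 1 := by rw [norm_smul, norm_inv, norm_norm, inv_mul_cancel₀ h0']
  have hsum : y + z = ‖y + z‖ • x := by rw [hxdef, smul_inv_smul₀ h0']
  obtain ⟨hj1, hj2⟩ := hj x hx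
  have hjs : j x y + j x z = ‖y + z‖ := by
    rw [← map_add]; conv_lhs => rw [hsum]
    rw [map_smul, hj2, smul_eq_mul, mul_one]
  have hval : ∀ w : X, ‖w‖ = 1 → linError (normPow p) (j x) w x = 1 - j x w := by
    intro w hw
    rw [linError_normPow hx hj2, hw, Real.one_rpow]; ring
  have hEy := linError_normPow_nonneg hp hx hj1 hj2 y
  have hEz := linError_normPow_nonneg hp hx hj1 hj2 z
  have htri : ε ≤ ‖x - y‖ + ‖x - z‖ := by
    rw [← hyz, norm_sub_rev x y]; exact norm_sub_le_norm_sub_add_norm_sub y x z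
  rw [hval y hy] at hEy
  rw [hval z hz] at hEz
  rcases le_total (ε / 2) ‖x - y‖ with hd | hd
  · have := far x y hx hd
    rw [hval y hy] at this
    linarith
  · have := far x z hx (by linarith)
    rw [hval z hz] at this
    linarith

lemma IsDualitySelection.norm_and_apply {p : ℝ} {j : X → StrongDual ℝ X}
    (hj : IsDualitySelection p j) {x : X} (hx : ‖x‖ = 1) : ‖j x‖ = 1 ∧ j x x = 1 := by
  obtain ⟨h1, h2⟩ := hj x
  rw [hx, Real.one_rpow] at h2
  exact ⟨h2, by rw [h1, h2, hx, mul_one]⟩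

end BregmanNorm

theorem mainTheorem1 :
    ∃ C D : ℝ → ℝ → ℝ,
      (∀ τ₀ p : ℝ, 0 < τ₀ → 1 < p → 0 < C τ₀ p ∧ 0 < D τ₀ p) ∧
      ∀ (p : ℝ), 1 < p →
      ∀ (X : Type*) [NormedAddCommGroup X] [NormedSpace ℝ X] [CompleteSpace X],
        2 ≤ Module.rank ℝ X →
      ∀ j : X → StrongDual ℝ X, BregmanNorm.IsDualitySelection p j →
        -- (1) local upper bound
        (∀ τ₀ : ℝ, 0 < τ₀ → ∀ x : X, ‖x‖ = 1 → ∀ τ : ℝ, 0 ≤ τ → τ ≤ τ₀ →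
          BregmanNorm.smoothnessModulusAt (BregmanNorm.normPow p) x (j x) τ
            ≤ ((C τ₀ p * BregmanNorm.smoothnessModulus X τ : ℝ) : EReal)) ∧
        -- (2) converse of the upper bound
        (∀ τ₀ : ℝ, 0 < τ₀ → ∀ φ : ℝ → ℝ,
          (∀ x : X, ‖x‖ = 1 → ∀ τ : ℝ, 0 < τ → τ ≤ τ₀ →
            BregmanNorm.smoothnessModulusAt (BregmanNorm.normPow p) x (j x) τ
              ≤ ((φ τ : ℝ) : EReal)) →
          (∀ τ : ℝ, 0 < τ → τ ≤ τ₀ →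
            BregmanNorm.smoothnessModulus X τ ≤ φ τ + D τ₀ p * τ ^ 2) ∧
          (Tendsto (fun τ : ℝ => φ τ / τ) (𝓝[>] 0) (𝓝 0) → BregmanNorm.UniformlySmooth X)) ∧
        -- (3) local lower bound, with the constant of (1) for the conjugate exponent
        (∀ p' : ℝ, 1 / p + 1 / p' = 1 → ∀ τ₀ : ℝ, 0 < τ₀ →
          0 < BregmanNorm.smoothnessModulus (StrongDual ℝ X) τ₀ / τ₀ ∧
          ∀ x : X, ‖x‖ = 1 → ∀ τ : ℝ, 0 ≤ τ →
            τ ≤ C τ₀ p' * (BregmanNorm.smoothnessModulus (StrongDual ℝ X) τ₀ / τ₀) →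
            ((C τ₀ p' * BregmanNorm.convexityModulus X (τ / C τ₀ p') : ℝ) : EReal)
              ≤ BregmanNorm.convexityModulusAt (BregmanNorm.normPow p) x (j x) τ) ∧
        -- (4) converse of the lower bound
        (∀ τ₀ : ℝ, 0 < τ₀ → ∀ φ : ℝ → ℝ,
          MonotoneOn φ (Ioi 0) → (∀ τ : ℝ, 0 < τ → 0 < φ τ) →
          (∀ x : X, ‖x‖ = 1 → ∀ τ : ℝ, 0 < τ → τ ≤ τ₀ →
            ((φ τ : ℝ) : EReal)
              ≤ BregmanNorm.convexityModulusAt (BregmanNorm.normPow p) x (j x) τ) →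
          BregmanNorm.UniformlyConvex X) := by
  -- The converse holds without the `τ²` term, so any positive `D` works.
  refine ⟨BregmanNorm.smoothnessConst, fun _ _ => 1,
    fun τ₀ p hτ₀ hp => ⟨BregmanNorm.smoothnessConst_pos hτ₀ hp, one_pos⟩, ?_⟩
  intro p hp X _ _ _ hrank j hjs
  have hX := BregmanNorm.exists_ne_zero_apply_eq_zero hrank
  have hX' := BregmanNorm.exists_ne_zero_apply_eq_zero_dual hX
  have hj : ∀ x : X, ‖x‖ = 1 → ‖j x‖ = 1 ∧ j x x = 1 := fun x hx => hjs.norm_and_apply hx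
  obtain ⟨u₀, h₀, -⟩ := hX 0
  have : Nontrivial X := ⟨u₀, 0, h₀⟩
  have habs : ∀ x y : X, ‖x‖ = 1 → |BregmanNorm.linError (BregmanNorm.normPow p) (j x) y x| =
      BregmanNorm.linError (BregmanNorm.normPow p) (j x) y x := fun x y hx =>
    abs_of_nonneg (BregmanNorm.linError_normPow_nonneg hp hx (hj x hx).1 (hj x hx).2 y)
  refine ⟨?_, ?_, ?_, ?_⟩
  · intro τ₀ _ x hx τ hτ hττ₀
    refine iSup₂_le fun y hy => EReal.coe_le_coe_iff.2 ?_
    rw [habs x y hx]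
    exact BregmanNorm.linError_normPow_le hX hp hτ hττ₀ hx (hj x hx).1 (hj x hx).2 hy
  · intro τ₀ hτ₀ φ hφ
    have key : ∀ τ : ℝ, 0 < τ → τ ≤ τ₀ → BregmanNorm.smoothnessModulus X τ ≤ φ τ := by
      intro τ hτ hττ₀
      refine BregmanNorm.smoothnessModulus_le_of_linError_le hp hτ.le (fun x hx => (hj x hx).2)
        fun x y hx hxy => ?_
      rw [← habs x y hx, ← EReal.coe_le_coe_iff]
      exact (le_iSup₂ (f := fun (y : X) (_ : ‖x - y‖ = τ) =>
        ((|BregmanNorm.linError (BregmanNorm.normPow p) (j x) y x| : ℝ) : EReal)) y hxy).trans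
        (hφ x hx τ hτ hττ₀)
    refine ⟨fun τ hτ hττ₀ => (key τ hτ hττ₀).trans ?_,
      fun h => BregmanNorm.uniformlySmooth_of_le hτ₀ key h⟩
    linarith [sq_nonneg τ]
  · intro p' hpp' τ₀ hτ₀
    have hconj : p.HolderConjugate p' :=
      Real.holderConjugate_iff.2 ⟨hp, by simpa using hpp'⟩
    refine ⟨div_pos ?_ hτ₀, fun x hx τ _ hτ => le_iInf₂ fun y hy => EReal.coe_le_coe_iff.2 ?_⟩
    · have h1 := BregmanNorm.sq_le_smoothnessModulus hX' hτ₀.le le_rfl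
      exact pos_of_mul_pos_right ((pow_pos hτ₀ 2).trans_le h1) (by positivity)
    · rw [habs x y hx]
      subst hy
      exact BregmanNorm.convexityModulus_le_linError hX hconj hτ₀ hx (hj x hx).1 (hj x hx).2 hτ
  · intro τ₀ hτ₀ φ hmono hpos hφ
    refine BregmanNorm.uniformlyConvex_of_le_linError hrank hp hτ₀ hj hmono hpos
      fun x y hx hxy hxyτ => ?_
    rw [← habs x y hx, ← EReal.coe_le_coe_iff]
    exact (hφ x hx _ hxy hxyτ).trans (iInf₂_le (f := fun (y' : X) (_ : ‖x - y'‖ = ‖x - y‖) =>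
      ((|BregmanNorm.linError (BregmanNorm.normPow p) (j x) y' x| : ℝ) : EReal)) y rfl)
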